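/- Metric spaces are allowed infinite distances. Let $\mathrm{CMet}$ be the category of complete metric spaces and non-expansive maps; for $X,Y\in\mathrm{CMet}$ the set $\hom(X,Y)$ of non-expansive maps is itself an object of $\mathrm{CMet}$ under the supremum distance. Let $\mathcal C^*_1$ be the category of unital $C^*$-algebras (the zero algebra included) and unital $*$-homomorphisms; for $C,A\in\mathcal C^*_1$ the set $\hom(C,A)$ is an object of $\mathrm{CMet}$ under the distance $d(f,g)=\sup_{\|a\|\le 1}\|f(a)-g(a)\|$. For $X\in\mathrm{CMet}$ and $C\in\mathcal C^*_1$, a tensor product $X\otimes C$ is a unital $C^*$-algebra $T$ representing the $\mathrm{CMet}$-valued functor $\hom(X,\hom(C,-))$ on $\mathcal C^*_1$, i.e. such that there are isometric bijections $\hom(T,A)\cong\hom(X,\hom(C,A))$ natural in $A$; the category $\mathcal C^*_1$ is $\mathrm{CMet}$-tensored if $X\otimes C$ exists for all $X$ and $C$. **Theorem.** For a unital $C^*$-algebra $C$ and a complete metric space $X$ the tensor product $X\otimes C$ exists if and only if one of the following conditions holds: - $X$ is empty, in which case $X\otimes C\cong\mathbb C$; - $X$ is a singleton, in which case $X\otimes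 C\cong C$; - $\dim C\le 1$ (i.e. $C$ is $\{0\}$ or $\mathbb C$), in which case $X\otimes C\cong C$ provided that $X$ is non-empty. Here the isomorphisms mean that a unital $C^*$-algebra is a tensor product of $X$ and $C$ if and only if it is $*$-isomorphic to the indicated algebra. Consequently, the category $\mathcal C^*_1$ is not $\mathrm{CMet}$-tensored. -/

import Mathlib

open CategoryTheory Filter Topology
open scoped ENNReal

universe u

/-- Pointwise limits plus a supremum metric give completeness. -/
theorem completeSpace_of_edist_eq_iSup {F S Y : Type*} [EMetricSpace F] [EMetricSpace Y]
    [CompleteSpace Y] (ev : F → S → Y) (h : ∀ f g, edist f g = ⨆ s, edist (ev f s) (ev g s))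
    (hlim : ∀ (v : ℕ → F) (l : S → Y),
      (∀ s, Tendsto (fun n => ev (v n) s) atTop (𝓝 (l s))) → ∃ f, ev f = l) :
    CompleteSpace F := by
  refine EMetric.complete_of_cauchySeq_tendsto fun v hv => ?_
  have hs : ∀ f g s, edist (ev f s) (ev g s) ≤ edist f g := fun f g s => by
    rw [h]; exact le_iSup (fun s => edist (ev f s) (ev g s)) s
  have hc : ∀ s, ∃ y, Tendsto (fun n => ev (v n) s) atTop (𝓝 y) := fun s => by
    refine cauchySeq_tendsto_of_complete (EMetric.cauchySeq_iff.2 fun ε hε => ?_)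
    obtain ⟨N, hN⟩ := EMetric.cauchySeq_iff.1 hv ε hε
    exact ⟨N, fun m hm n hn => (hs _ _ s).trans_lt (hN m hm n hn)⟩
  choose l hl using hc
  obtain ⟨f, rfl⟩ := hlim v l hl
  refine ⟨f, EMetric.tendsto_atTop.2 fun ε hε => ?_⟩
  obtain ⟨δ, hδ, hδε⟩ := exists_between hε
  obtain ⟨N, hN⟩ := EMetric.cauchySeq_iff.1 hv δ hδ
  refine ⟨N, fun n hn => lt_of_le_of_lt ?_ hδε⟩
  rw [h]
  refine iSup_le fun s => ?_
  refine le_of_tendsto (tendsto_const_nhds.edist (hl s)) ?_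
  filter_upwards [eventually_ge_atTop N] with m hm
  exact (hs _ _ s).trans (hN n hn m hm).le

/-! ### Complete metric spaces, with infinite distances allowed -/

/-- A complete metric space; distances take values in `[0, ∞]`. -/
structure CMet : Type (u + 1) where
  carrier : Type u
  [emetric : EMetricSpace carrier]
  [complete : CompleteSpace carrier]

attribute [instance] CMet.emetric CMet.complete

instance : CoeSort CMet.{u} (Type u) := ⟨CMet.carrier⟩

/-- Non-expansive maps. -/
@[ext]
structure NonExp (X Y : Type*) [EMetricSpace X] [EMetricSpace Y] where
  toFun : X → Y
  lipschitz : LipschitzWith 1 toFun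

namespace NonExp

instance {X Y : Type*} [EMetricSpace X] [EMetricSpace Y] :
    CoeFun (NonExp X Y) (fun _ => X → Y) := ⟨NonExp.toFun⟩

/-- Composition of non-expansive maps. -/
def comp {X Y Z : Type*} [EMetricSpace X] [EMetricSpace Y] [EMetricSpace Z]
    (g : NonExp Y Z) (f : NonExp X Y) : NonExp X Z :=
  ⟨fun x => g (f x), by simpa [Function.comp_def] using g.lipschitz.comp f.lipschitz⟩

/-- The supremum distance between non-expansive maps. -/
noncomputable instance {X Y : Type*} [EMetricSpace X] [EMetricSpace Y] : EMetricSpace (NonExp X Y) where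
  edist f g := ⨆ x, edist (f x) (g x)
  edist_self f := by simp
  edist_comm f g := by simp only [edist_comm]
  edist_triangle f g h := iSup_le fun x => (edist_triangle _ (g x) _).trans
    (add_le_add (le_iSup (fun x => edist (f x) (g x)) x)
      (le_iSup (fun x => edist (g x) (h x)) x))
  eq_of_edist_eq_zero {f g} h := by
    ext x
    refine edist_le_zero.1 (le_trans (le_iSup (fun x => edist (f x) (g x)) x) (le_of_eq h))

theorem edist_def {X Y : Type*} [EMetricSpace X] [EMetricSpace Y] (f g : NonExp X Y) :
    edist f g = ⨆ x, edist (f x) (g x) := rfl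

instance {X Y : Type*} [EMetricSpace X] [EMetricSpace Y] [CompleteSpace Y] :
    CompleteSpace (NonExp X Y) := by
  refine completeSpace_of_edist_eq_iSup NonExp.toFun edist_def fun v l hl => ?_
  refine ⟨⟨l, fun x y => ?_⟩, rfl⟩
  exact le_of_tendsto ((hl x).edist (hl y)) (Eventually.of_forall fun n => (v n).lipschitz x y)

/-- Post-composition with a non-expansive map, as a non-expansive map of hom spaces. -/
noncomputable def postcomp (X : Type*) {Y Z : Type*} [EMetricSpace X] [EMetricSpace Y] [EMetricSpace Z]
    (g : NonExp Y Z) : NonExp (NonExp X Y) (NonExp X Z) :=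
  ⟨fun f => g.comp f, fun f f' => by
    simp only [edist_def, ENNReal.coe_one, one_mul]
    exact iSup_mono fun x => by simpa using! g.lipschitz (f x) (f' x)⟩

end NonExp

/-- The category of complete metric spaces and non-expansive maps. -/
instance : Category CMet.{u} where
  Hom X Y := NonExp X Y
  id X := ⟨id, LipschitzWith.id⟩
  comp f g := NonExp.comp g f

/-- The internal hom `hom(X, -)`: non-expansive maps out of `X` with the supremum distance. -/
noncomputable def CMet.homFunctor (X : CMet.{u}) : CMet.{u} ⥤ CMet.{u} where
  obj Y := ⟨NonExp X Y⟩
  map g := NonExp.postcomp X g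

/-! ### Unital C⋆-algebras -/

/-- A unital (complex) C⋆-algebra; the zero algebra is allowed. -/
structure UnitalCStar : Type (u + 1) where
  carrier : Type u
  [cstar : CStarAlgebra carrier]

attribute [instance] UnitalCStar.cstar

instance : CoeSort UnitalCStar.{u} (Type u) := ⟨UnitalCStar.carrier⟩

namespace UnitalCStar

/-- The distance between unital `*`-homomorphisms: uniform distance on the closed unit ball. -/
noncomputable instance {C A : Type*} [CStarAlgebra C] [CStarAlgebra A] : EMetricSpace (C →⋆ₐ[ℂ] A) where
  edist f g := ⨆ a : {a : C // ‖a‖ ≤ 1}, edist (f a) (g a)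
  edist_self f := by simp
  edist_comm f g := by simp only [edist_comm]
  edist_triangle f g h := iSup_le fun x => (edist_triangle _ (g x) _).trans
    (add_le_add (le_iSup (fun x : {a : C // ‖a‖ ≤ 1} => edist (f x) (g x)) x)
      (le_iSup (fun x : {a : C // ‖a‖ ≤ 1} => edist (g x) (h x)) x))
  eq_of_edist_eq_zero {f g} h := by
    have h1 : ∀ a : C, ‖a‖ ≤ 1 → f a = g a := fun a ha => edist_le_zero.1
      (le_trans (le_iSup (fun x : {a : C // ‖a‖ ≤ 1} => edist (f x) (g x)) ⟨a, ha⟩) (le_of_eq h))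
    ext a
    have hc : (0 : ℝ) < ‖a‖ + 1 := by positivity
    have hc' : ((‖a‖ + 1 : ℝ) : ℂ) ≠ 0 := by exact_mod_cast hc.ne'
    have h2 := h1 (((‖a‖ + 1 : ℝ) : ℂ)⁻¹ • a) (by
      rw [norm_smul, norm_inv, Complex.norm_real, Real.norm_of_nonneg hc.le,
        inv_mul_le_iff₀ hc]
      linarith)
    rw [map_smul, map_smul] at h2
    exact smul_right_injective A (inv_ne_zero hc') h2

theorem edist_def {C A : Type*} [CStarAlgebra C] [CStarAlgebra A] (f g : C →⋆ₐ[ℂ] A) :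
    edist f g = ⨆ a : {a : C // ‖a‖ ≤ 1}, edist (f a) (g a) := rfl

instance {C A : Type*} [CStarAlgebra C] [CStarAlgebra A] : CompleteSpace (C →⋆ₐ[ℂ] A) := by
  refine completeSpace_of_edist_eq_iSup
    (fun (f : C →⋆ₐ[ℂ] A) (a : {a : C // ‖a‖ ≤ 1}) => f a) edist_def fun v l hl => ?_
  have hex : ∀ a : C, ∃ y : A, Tendsto (fun n => v n a) atTop (𝓝 y) := fun a => by
    have hc : (0 : ℝ) < ‖a‖ + 1 := by positivity
    have hc' : ((‖a‖ + 1 : ℝ) : ℂ) ≠ 0 := by exact_mod_cast hc.ne'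
    have h2 := hl ⟨((‖a‖ + 1 : ℝ) : ℂ)⁻¹ • a, by
      rw [norm_smul, norm_inv, Complex.norm_real, Real.norm_of_nonneg hc.le,
        inv_mul_le_iff₀ hc]
      linarith⟩
    refine ⟨_, (h2.const_smul ((‖a‖ + 1 : ℝ) : ℂ)).congr fun n => ?_⟩
    simp only [map_smul]
    rw [smul_inv_smul₀ hc']
  choose L hL using hex
  have uniq : ∀ {a : C} {y : A}, Tendsto (fun n => v n a) atTop (𝓝 y) → L a = y :=
    fun h => tendsto_nhds_unique (hL _) h
  refine ⟨{ toFun := L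
            map_one' := uniq (by simp)
            map_mul' := fun a b => uniq (by simpa using (hL a).mul (hL b))
            map_zero' := uniq (by simp)
            map_add' := fun a b => uniq (by simpa using (hL a).add (hL b))
            commutes' := fun r => uniq (by simp [AlgHomClass.commutes])
            map_star' := fun a => uniq (by simpa only [map_star] using (hL a).star) }, ?_⟩
  funext a
  exact uniq (hl a)

/-- Post-composition with a unital `*`-homomorphism, as a non-expansive map of hom spaces. -/
noncomputable def postcomp (C : Type*) {A B : Type*} [CStarAlgebra C] [CStarAlgebra A] [CStarAlgebra B]
    (g : A →⋆ₐ[ℂ] B) : NonExp (C →⋆ₐ[ℂ] A) (C →⋆ₐ[ℂ] B) :=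
  ⟨fun f => g.comp f, fun f f' => by
    simp only [edist_def, ENNReal.coe_one, one_mul]
    refine iSup_mono fun a => ?_
    rw [StarAlgHom.comp_apply, StarAlgHom.comp_apply, edist_eq_enorm_sub, edist_eq_enorm_sub,
      ← map_sub, enorm_le_iff_norm_le]
    exact NonUnitalStarAlgHom.norm_apply_le g _⟩

/-- The category of unital C⋆-algebras and unital `*`-homomorphisms. -/
instance : Category UnitalCStar.{u} where
  Hom A B := A →⋆ₐ[ℂ] B
  id A := StarAlgHom.id ℂ A
  comp f g := StarAlgHom.comp g f

/-- The enriched hom functor `hom(C, -)`, with values in complete metric spaces. -/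
noncomputable def homFunctor (C : UnitalCStar.{u}) : UnitalCStar.{u} ⥤ CMet.{u} where
  obj A := ⟨C →⋆ₐ[ℂ] A⟩
  map g := postcomp C g

/-- The composition of unital `*`-homomorphisms is non-expansive for the sum metric on pairs, so
the hom spaces enrich unital C⋆-algebras over complete metric spaces. -/
theorem edist_comp_le {A B C : Type*} [CStarAlgebra A] [CStarAlgebra B] [CStarAlgebra C]
    (g g' : B →⋆ₐ[ℂ] C) (f f' : A →⋆ₐ[ℂ] B) :
    edist (g.comp f) (g'.comp f') ≤ edist g g' + edist f f' := by
  refine (edist_triangle _ (g'.comp f) _).trans (add_le_add ?_ ?_)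
  · refine iSup_le fun a => ?_
    exact le_iSup (fun b : {b : B // ‖b‖ ≤ 1} => edist (g b) (g' b))
      ⟨f a, (NonUnitalStarAlgHom.norm_apply_le f _).trans a.2⟩
  · simpa using! (postcomp A g').lipschitz f f'

/-- `T` is a tensor product of `X` and `C` over complete metric spaces: it represents the functor
`hom(X, hom(C, -))` from unital C⋆-algebras to complete metric spaces. The isomorphisms
`hom(T, A) ≅ hom(X, hom(C, A))` live in `CMet`, i.e. they are isometric bijections. Since a
morphism of `CMet` is determined by its values at points, naturality in the enriched sense is
the same as naturality in the ordinary sense. -/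
def IsTensor (X : CMet.{u}) (C T : UnitalCStar.{u}) : Prop :=
  Nonempty (homFunctor T ≅ homFunctor C ⋙ X.homFunctor)

/-- The tensor product of `X` and `C` exists. -/
def HasTensor (X : CMet.{u}) (C : UnitalCStar.{u}) : Prop :=
  ∃ T : UnitalCStar.{u}, IsTensor X C T

end UnitalCStar

/-- Unital C⋆-algebras are tensored over complete metric spaces: all tensor products exist. -/
def UnitalCStarIsCMetTensored : Prop :=
  ∀ (X : CMet.{u}) (C : UnitalCStar.{u}), UnitalCStar.HasTensor X C

/-! Existence in the three cases is formal. If `X` is empty, `hom(X, -)` is a point and `ℂ` is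
initial; if `X` is a point, `hom(X, -)` is the identity; if `C` is spanned by `1`, every hom space
out of `C` has at most one point. Yoneda gives uniqueness up to isomorphism.

For the converse, suppose `X` has two points, `dim C ≥ 2`, and a tensor product `T` exists. Then `T`
carries a universal family `η x : C → T`, and the isometry condition says that distances between
homomorphisms out of `T` can be measured on this family alone (`IsTensor.exists_universal`). This
fails because small differences `η x₁ a - η x₀ a` can be rescaled to elements of `T` on which two
homomorphisms differ much more.

To see this, pick an endomorphism `ρ ≠ id` of `C` and work in two-by-two matrices over `C`.
Conjugating `σ = diag(id, ρ)` by rotations through small angles `θ x` gives a non-expansive family,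
hence `f : T → A` restricting to it. The symmetry `w = diag(1, -1)` induces an automorphism `R` that
turns each angle `θ x` into `-θ x`, so `f` and `R ∘ f` are within `1/2` on the family. Dividing by
`sin t` produces an element of the range of `f` of norm `1` (`RotationData.hom_sub_hom_zero`) that
`R` moves by `2 |cos t| ≥ 1` (`RotationData.norm_sub_reflection`). It lifts to a contraction in `T`,
so `f` and `R ∘ f` are at distance at least `1`, a contradiction. -/

namespace UnitalCStar

/-! ### Universal families and uniqueness of tensor products -/

/-- An isomorphism of complete metric spaces preserves distances. -/
theorem edist_iso_hom {Y Z : CMet.{u}} (e : Y ≅ Z) (y y' : Y) :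
    edist (NonExp.toFun e.hom y) (NonExp.toFun e.hom y') = edist y y' := by
  have hinv : ∀ y, NonExp.toFun e.inv (NonExp.toFun e.hom y) = y := fun y =>
    congrArg (fun f : NonExp Y Y => f y) e.hom_inv_id
  refine le_antisymm ?_ ?_
  · simpa using NonExp.lipschitz e.hom y y'
  · simpa [hinv] using NonExp.lipschitz e.inv (NonExp.toFun e.hom y) (NonExp.toFun e.hom y')

/-- A tensor product carries a universal family of homomorphisms, and distances of homomorphisms
out of it are computed on this family. -/
theorem IsTensor.exists_universal {X : CMet.{u}} {C T : UnitalCStar.{u}} (h : IsTensor X C T) :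
    ∃ η : X → (C →⋆ₐ[ℂ] T), ∀ A : UnitalCStar.{u},
      (∀ F : NonExp X (C →⋆ₐ[ℂ] A), ∃ f : T →⋆ₐ[ℂ] A, ∀ x, f.comp (η x) = F x) ∧
      ∀ f g : T →⋆ₐ[ℂ] A, edist f g = ⨆ x, edist (f.comp (η x)) (g.comp (η x)) := by
  obtain ⟨e⟩ := h
  let ev (A : UnitalCStar.{u}) : (T →⋆ₐ[ℂ] A) → NonExp X (C →⋆ₐ[ℂ] A) :=
    NonExp.toFun (e.hom.app A)
  let η : NonExp X (C →⋆ₐ[ℂ] T) := ev T (StarAlgHom.id ℂ T)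
  -- Yoneda: naturality along `f`, evaluated at the identity of `T`.
  have key : ∀ (A : UnitalCStar.{u}) (f : T →⋆ₐ[ℂ] A) (x : X),
      f.comp (η x) = (ev A f) x := fun A f x => by
    have hn := e.hom.naturality (X := T) (Y := A) f
    have h2 := congrArg (fun k : NonExp (T →⋆ₐ[ℂ] T) (NonExp X (C →⋆ₐ[ℂ] A)) =>
      (k (StarAlgHom.id ℂ T)) x) hn
    exact h2.symm
  refine ⟨η, fun A => ⟨fun F => ?_, fun f g => ?_⟩⟩
  · refine ⟨NonExp.toFun (e.inv.app A) F, fun x => ?_⟩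
    rw [key]
    exact congrArg (fun k : NonExp (NonExp X (C →⋆ₐ[ℂ] A)) (NonExp X (C →⋆ₐ[ℂ] A)) => (k F) x)
      (e.inv_hom_id_app A)
  · simp only [key]
    exact (edist_iso_hom (e.app A) f g).symm

/-- Isomorphic algebras have isomorphic enriched hom functors. -/
theorem nonempty_homFunctor_iso_iff {S T : UnitalCStar.{u}} :
    Nonempty (homFunctor T ≅ homFunctor S) ↔ Nonempty (T ≃⋆ₐ[ℂ] S) := by
  constructor
  · rintro ⟨e⟩
    let p : S →⋆ₐ[ℂ] T := NonExp.toFun (e.hom.app T) (StarAlgHom.id ℂ T)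
    let q : T →⋆ₐ[ℂ] S := NonExp.toFun (e.inv.app S) (StarAlgHom.id ℂ S)
    have hp : ∀ (A : UnitalCStar.{u}) (f : T →⋆ₐ[ℂ] A),
        f.comp p = NonExp.toFun (e.hom.app A) f := fun A f =>
      (congrArg (fun k : NonExp (T →⋆ₐ[ℂ] T) (S →⋆ₐ[ℂ] A) => k (StarAlgHom.id ℂ T))
        (e.hom.naturality (X := T) (Y := A) f)).symm
    have hq : ∀ (A : UnitalCStar.{u}) (f : S →⋆ₐ[ℂ] A),
        f.comp q = NonExp.toFun (e.inv.app A) f := fun A f =>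
      (congrArg (fun k : NonExp (S →⋆ₐ[ℂ] S) (T →⋆ₐ[ℂ] A) => k (StarAlgHom.id ℂ S))
        (e.inv.naturality (X := S) (Y := A) f)).symm
    have h1 : p.comp q = StarAlgHom.id ℂ T := by
      rw [hq]
      exact congrArg (fun k : NonExp (T →⋆ₐ[ℂ] T) (T →⋆ₐ[ℂ] T) => k (StarAlgHom.id ℂ T))
        (e.hom_inv_id_app T)
    have h2 : q.comp p = StarAlgHom.id ℂ S := by
      rw [hp]
      exact congrArg (fun k : NonExp (S →⋆ₐ[ℂ] S) (S →⋆ₐ[ℂ] S) => k (StarAlgHom.id ℂ S))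
        (e.inv_hom_id_app S)
    exact ⟨StarAlgEquiv.ofStarAlgHom q p h1 h2⟩
  · rintro ⟨e⟩
    have hnat : ∀ {P Q : UnitalCStar.{u}} (k : P →⋆ₐ[ℂ] Q) (A : UnitalCStar.{u}),
        LipschitzWith 1 (fun f : Q →⋆ₐ[ℂ] A => f.comp k) := fun {P Q} k A f f' => by
      simpa using! edist_comp_le f f' k k
    refine ⟨NatIso.ofComponents
      (fun A => { hom := ⟨fun f => StarAlgHom.comp f (e.symm : S →⋆ₐ[ℂ] T), hnat _ A⟩
                  inv := ⟨fun f => StarAlgHom.comp f (e : T →⋆ₐ[ℂ] S), hnat _ A⟩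
                  hom_inv_id := ?_
                  inv_hom_id := ?_ }) ?_⟩
    · refine NonExp.ext (funext fun f => ?_)
      refine StarAlgHom.ext fun t => ?_
      exact congrArg (fun t => (show T →⋆ₐ[ℂ] A from f) t) (e.symm_apply_apply t)
    · refine NonExp.ext (funext fun f => ?_)
      refine StarAlgHom.ext fun t => ?_
      exact congrArg (fun t => (show S →⋆ₐ[ℂ] A from f) t) (e.apply_symm_apply t)
    · intro A B g
      rfl

/-- Tensor products are unique up to isomorphism, and every isomorphic algebra is one. -/
theorem IsTensor.iff_nonempty_starAlgEquiv {X : CMet.{u}} {C S : UnitalCStar.{u}}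
    (hS : IsTensor X C S) (T : UnitalCStar.{u}) : IsTensor X C T ↔ Nonempty (T ≃⋆ₐ[ℂ] S) := by
  rw [← nonempty_homFunctor_iso_iff]
  obtain ⟨e⟩ := hS
  exact ⟨fun ⟨f⟩ => ⟨f ≪≫ e.symm⟩, fun ⟨f⟩ => ⟨f ≪≫ e⟩⟩

/-! ### Existence of tensor products in the degenerate cases -/

/-- Tensoring with a one-point space does nothing. -/
theorem isTensor_self_of_unique (X : CMet.{u}) [Unique X] (C : UnitalCStar.{u}) :
    IsTensor X C C := by
  refine ⟨NatIso.ofComponents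
    (fun A => { hom := ⟨fun f => (⟨fun _ => f, LipschitzWith.const' f⟩ : NonExp X (C →⋆ₐ[ℂ] A)), ?_⟩
                inv := ⟨fun F => NonExp.toFun F default, ?_⟩
                hom_inv_id := ?_
                inv_hom_id := ?_ }) ?_⟩
  · intro f g
    rw [ENNReal.coe_one, one_mul]
    exact iSup_le fun _ => le_rfl
  · intro F G
    rw [ENNReal.coe_one, one_mul]
    exact le_iSup (fun x : X => edist (NonExp.toFun F x) (NonExp.toFun G x)) default
  · rfl
  · refine NonExp.ext (funext fun F => NonExp.ext (funext fun x => ?_))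
    exact congrArg (NonExp.toFun F) (Subsingleton.elim default x)
  · intro A B g
    rfl

/-- When all hom spaces have at most one point, representability is a matter of existence. -/
theorem isTensor_of_subsingleton {X : CMet.{u}} {C T : UnitalCStar.{u}}
    (hT : ∀ A : UnitalCStar.{u}, Subsingleton (T →⋆ₐ[ℂ] A))
    (hX : ∀ A : UnitalCStar.{u}, Subsingleton (NonExp X (C →⋆ₐ[ℂ] A)))
    (hom : ∀ A : UnitalCStar.{u}, (T →⋆ₐ[ℂ] A) → NonExp X (C →⋆ₐ[ℂ] A))
    (inv : ∀ A : UnitalCStar.{u}, NonExp X (C →⋆ₐ[ℂ] A) → (T →⋆ₐ[ℂ] A)) : IsTensor X C T := by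
  refine ⟨NatIso.ofComponents
    (fun A => { hom := ⟨hom A, ?_⟩
                inv := ⟨inv A, ?_⟩
                hom_inv_id := ?_
                inv_hom_id := ?_ }) ?_⟩
  · intro f g
    rw [(hT A).elim f g]
    exact (edist_self _).trans_le zero_le
  · intro f g
    rw [(hX A).elim f g]
    exact (edist_self _).trans_le zero_le
  · exact NonExp.ext (funext fun f => (hT A).elim _ _)
  · exact NonExp.ext (funext fun f => (hX A).elim _ _)
  · intro A B g
    exact NonExp.ext (funext fun f => (hX B).elim _ _)

theorem exists_smul_one_eq {C : Type*} [CStarAlgebra C] (h : Module.rank ℂ C ≤ 1) (a : C) :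
    ∃ r : ℂ, r • (1 : C) = a := by
  obtain ⟨v, hv⟩ := rank_le_one_iff.1 h
  obtain ⟨r, hr⟩ := hv 1
  obtain ⟨s, rfl⟩ := hv a
  -- `r = 0` means `1 = 0`, the case of the zero algebra.
  rcases eq_or_ne r 0 with rfl | h0
  · rw [zero_smul] at hr
    have := subsingleton_of_zero_eq_one hr
    exact ⟨0, Subsingleton.elim _ _⟩
  · exact ⟨s * r⁻¹, by rw [← hr, smul_smul, mul_assoc, inv_mul_cancel₀ h0, mul_one]⟩

theorem subsingleton_starAlgHom {C : Type*} [CStarAlgebra C] (h : Module.rank ℂ C ≤ 1)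
    (A : Type*) [CStarAlgebra A] : Subsingleton (C →⋆ₐ[ℂ] A) := by
  refine ⟨fun f g => StarAlgHom.ext fun a => ?_⟩
  obtain ⟨r, rfl⟩ := exists_smul_one_eq h a
  simp

/-- An algebra of dimension at most one absorbs every non-empty space. -/
theorem isTensor_self_of_rank_le_one (X : CMet.{u}) [Nonempty X] (C : UnitalCStar.{u})
    (h : Module.rank ℂ C ≤ 1) : IsTensor X C C := by
  refine isTensor_of_subsingleton (fun A => subsingleton_starAlgHom h A) (fun A => ?_)
    (fun A f => ⟨fun _ => f, LipschitzWith.const' f⟩) (fun A F => F (Classical.arbitrary X))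
  have := subsingleton_starAlgHom h A
  exact ⟨fun F G => NonExp.ext (Subsingleton.elim _ _)⟩

/-- The complex numbers in an arbitrary universe. -/
noncomputable def complex : UnitalCStar.{u} := ⟨C(PUnit.{u + 1}, ℂ)⟩

noncomputable def complexEquiv : complex.{u} ≃⋆ₐ[ℂ] ℂ :=
  StarAlgEquiv.ofBijective (ContinuousMap.evalStarAlgHom ℂ ℂ PUnit.unit :
      C(PUnit.{u + 1}, ℂ) →⋆ₐ[ℂ] ℂ)
    ⟨fun _ _ h => ContinuousMap.ext fun _ => h, fun z => ⟨ContinuousMap.const _ z, rfl⟩⟩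

theorem isTensor_complex_of_isEmpty (X : CMet.{u}) [IsEmpty X] (C : UnitalCStar.{u}) :
    IsTensor X C complex.{u} := by
  have h : Module.rank ℂ complex.{u} ≤ 1 :=
    rank_le_one_iff.2 ⟨complexEquiv.symm 1, fun v => ⟨complexEquiv v, by
      rw [← map_smul]; simp⟩⟩
  refine isTensor_of_subsingleton (fun A => subsingleton_starAlgHom h A) (fun A => ?_)
    (fun A f => ⟨isEmptyElim, fun x => isEmptyElim x⟩)
    (fun A F => (StarAlgHom.ofId ℂ A).comp (complexEquiv.{u} : complex.{u} →⋆ₐ[ℂ] ℂ))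
  exact ⟨fun F G => NonExp.ext (funext fun x => isEmptyElim x)⟩

end UnitalCStar

/-! ### Lifting contractions along `*`-homomorphisms -/

/-- A self-adjoint contraction in the image of a `*`-homomorphism, with a self-adjoint preimage, is
the image of a contraction. -/
theorem StarAlgHom.exists_norm_le_one_of_isSelfAdjoint {T A : Type*} [CStarAlgebra T]
    [CStarAlgebra A] (f : T →⋆ₐ[ℂ] A) {b : T} (hb : IsSelfAdjoint b) (h : ‖f b‖ ≤ 1) :
    ∃ b' : T, ‖b'‖ ≤ 1 ∧ f b' = f b := by
  have hfb : IsSelfAdjoint (f b) := hb.map f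
  have hf : Continuous f := AddMonoidHomClass.continuous_of_bound f 1 fun x => by
    simpa using NonUnitalStarAlgHom.norm_apply_le f x
  -- Clamping to `[-1, 1]` makes `b` a contraction and leaves `f b` unchanged, since the spectrum of
  -- `f b` already lies there.
  let c : ℝ → ℝ := fun x => max (-1) (min 1 x)
  have hc : Continuous c := by fun_prop
  refine ⟨cfc c b, ?_, ?_⟩
  · refine norm_cfc_le zero_le_one fun x _ => ?_
    rw [Real.norm_eq_abs, abs_le]
    exact ⟨le_max_left _ _, max_le (by norm_num) (min_le_left _ _)⟩
  · have h1 := StarAlgHomClass.map_cfc (S := ℂ) f c b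
    rw [h1]
    conv_rhs => rw [← cfc_id ℝ (f b)]
    refine cfc_congr fun x hx => ?_
    rcases subsingleton_or_nontrivial A with hA | hA
    · rw [spectrum.of_subsingleton] at hx
      exact hx.elim
    have hx1 : |x| ≤ 1 := (spectrum.norm_le_norm_of_mem hx).trans h
    rw [abs_le] at hx1
    simp only [c, id]
    rw [min_eq_right hx1.2, max_eq_right hx1.1]

/-! ### Rotations -/

/-- A `*`-homomorphism `σ`, its conjugate `σ'` by a rotation `J` through a right angle, and a
symmetry `w` that fixes `σ` and reverses `J`. -/
structure RotationData (C A : Type*) [CStarAlgebra C] [CStarAlgebra A] where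
  σ : C →⋆ₐ[ℂ] A
  σ' : C →⋆ₐ[ℂ] A
  J : A
  w : A
  star_J : star J = -J
  J_mul_J : J * J = -1
  star_w : star w = w
  w_mul_w : w * w = 1
  w_mul_J : w * J = -(J * w)
  w_mul_σ : ∀ a, w * σ a = σ a * w
  J_mul_σ : ∀ a, J * σ a = σ' a * J

namespace RotationData

variable {C A : Type*} [CStarAlgebra C] [CStarAlgebra A] (D : RotationData C A)

theorem J_mem_unitary : D.J ∈ unitary A := by
  rw [Unitary.mem_iff, D.star_J]
  simp [D.J_mul_J]

/-- The rotation through the angle `t`. -/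
noncomputable def rot (t : ℝ) : unitary A :=
  ⟨Real.cos t • 1 + Real.sin t • D.J, by
    have h : Real.cos t * Real.cos t + Real.sin t * Real.sin t = 1 := by
      rw [← sq, ← sq, Real.cos_sq_add_sin_sq]
    rw [Unitary.mem_iff]
    constructor <;>
    · simp only [star_add, star_smul, star_one, star_trivial, D.star_J, mul_add, add_mul,
        smul_mul_assoc, mul_smul_comm, mul_one, one_mul, D.J_mul_J, smul_neg, neg_mul, mul_neg,
        neg_neg]
      match_scalars <;> linarith⟩

theorem coe_rot (t : ℝ) : (D.rot t : A) = Real.cos t • 1 + Real.sin t • D.J := rfl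

theorem star_coe_rot (t : ℝ) : star (D.rot t : A) = Real.cos t • 1 - Real.sin t • D.J := by
  simp [coe_rot, D.star_J, sub_eq_add_neg]

theorem norm_J_le : ‖D.J‖ ≤ 1 := by
  rcases subsingleton_or_nontrivial A with hA | hA
  · simp [Subsingleton.elim D.J 0]
  · exact (CStarRing.norm_of_mem_unitary D.J_mem_unitary).le

theorem norm_one_le : ‖(1 : A)‖ ≤ 1 := by
  rcases subsingleton_or_nontrivial A with hA | hA
  · simp [Subsingleton.elim (1 : A) 0]
  · exact CStarRing.norm_one.le

theorem norm_rot_sub_rot_le (s t : ℝ) : ‖(D.rot s : A) - D.rot t‖ ≤ 2 * |s - t| := by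
  have h : (D.rot s : A) - D.rot t =
      (Real.cos s - Real.cos t) • 1 + (Real.sin s - Real.sin t) • D.J := by
    rw [coe_rot, coe_rot]; module
  rw [h]
  refine (norm_add_le _ _).trans ?_
  rw [norm_smul, norm_smul, Real.norm_eq_abs, Real.norm_eq_abs, two_mul]
  exact add_le_add
    ((mul_le_of_le_one_right (abs_nonneg _) norm_one_le).trans (Real.abs_cos_sub_cos_le s t))
    ((mul_le_of_le_one_right (abs_nonneg _) D.norm_J_le).trans (Real.abs_sin_sub_sin_le s t))

/-- The conjugate of `σ` by the rotation through the angle `t`. -/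
noncomputable def hom (t : ℝ) : C →⋆ₐ[ℂ] A :=
  (Unitary.conjStarAlgAut ℂ A (D.rot t) : A →⋆ₐ[ℂ] A).comp D.σ

theorem hom_apply (t : ℝ) (a : C) : D.hom t a = D.rot t * D.σ a * star (D.rot t : A) := rfl

theorem norm_hom_sub_hom_le (s t : ℝ) (a : C) :
    ‖D.hom s a - D.hom t a‖ ≤ 4 * |s - t| * ‖a‖ := by
  have h : D.hom s a - D.hom t a = ((D.rot s : A) - D.rot t) * D.σ a * star (D.rot s : A) +
      D.rot t * D.σ a * star ((D.rot s : A) - D.rot t) := by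
    rw [hom_apply, hom_apply, star_sub]; noncomm_ring
  have hσ : ‖D.σ a‖ ≤ ‖a‖ := NonUnitalStarAlgHom.norm_apply_le D.σ a
  have hr := D.norm_rot_sub_rot_le s t
  have h1 : ‖((D.rot s : A) - D.rot t) * D.σ a * star (D.rot s : A)‖ ≤ 2 * |s - t| * ‖a‖ := by
    rw [← Unitary.coe_star, CStarRing.norm_mul_coe_unitary]
    exact (norm_mul_le _ _).trans (mul_le_mul hr hσ (norm_nonneg _) (by positivity))
  have h2 : ‖D.rot t * D.σ a * star ((D.rot s : A) - D.rot t)‖ ≤ 2 * |s - t| * ‖a‖ := by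
    rw [mul_assoc, CStarRing.norm_coe_unitary_mul]
    refine (norm_mul_le _ _).trans ?_
    rw [norm_star, mul_comm]
    exact mul_le_mul hr hσ (norm_nonneg _) (by positivity)
  rw [h]
  refine (norm_add_le _ _).trans ?_
  linarith

theorem edist_hom_hom_le (s t : ℝ) : edist (D.hom s) (D.hom t) ≤ ENNReal.ofReal (4 * |s - t|) := by
  rw [UnitalCStar.edist_def]
  refine iSup_le fun a => ?_
  rw [edist_dist, dist_eq_norm]
  exact ENNReal.ofReal_le_ofReal ((D.norm_hom_sub_hom_le s t a).trans
    (mul_le_of_le_one_right (by positivity) a.2))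

theorem hom_zero : D.hom 0 = D.σ := by
  ext a
  simp [hom_apply, coe_rot]

/-- With `s = sin t`, `c = cos t`, expanding the conjugation gives `s² (σ' a - σ a) + s c (σ' a - σ
a) J`. The factor `s` comes out, and the remaining `s + c J` is a rotation, hence unitary, so after
division the norm does not depend on `t`. -/
theorem hom_sub_hom_zero (t : ℝ) (a : C) :
    D.hom t a - D.hom 0 a =
      Real.sin t • ((D.σ' a - D.σ a) * D.rot (Real.pi / 2 - t)) := by
  have h : Real.cos t * Real.cos t = 1 - Real.sin t * Real.sin t := by
    rw [← sq, ← sq, ← Real.cos_sq_add_sin_sq t, add_sub_cancel_right]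
  have hJJ : D.σ' a * D.J * D.J = -D.σ' a := by rw [mul_assoc, D.J_mul_J, mul_neg_one]
  rw [hom_zero, hom_apply, star_coe_rot, coe_rot, coe_rot, Real.cos_pi_div_two_sub,
    Real.sin_pi_div_two_sub]
  simp only [add_mul, mul_add, mul_sub, sub_mul, smul_mul_assoc, mul_smul_comm, mul_one, one_mul,
    D.J_mul_σ, hJJ]
  match_scalars <;> linarith

/-- The automorphism given by the symmetry `w`. -/
noncomputable def reflection : A →⋆ₐ[ℂ] A :=
  (Unitary.conjStarAlgAut ℂ A ⟨D.w, by rw [Unitary.mem_iff, D.star_w]; simp [D.w_mul_w]⟩ :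
    A →⋆ₐ[ℂ] A)

theorem reflection_apply (b : A) : D.reflection b = D.w * b * D.w := by
  conv_rhs => rw [← D.star_w]
  conv_rhs => enter [1, 1]; rw [D.star_w]
  rfl

theorem reflection_J : D.reflection D.J = -D.J := by
  rw [reflection_apply, D.w_mul_J, neg_mul, mul_assoc, D.w_mul_w, mul_one]

theorem reflection_σ (a : C) : D.reflection (D.σ a) = D.σ a := by
  rw [reflection_apply, D.w_mul_σ, mul_assoc, D.w_mul_w, mul_one]

theorem σ'_apply (a : C) : D.σ' a = -(D.J * D.σ a * D.J) := by
  rw [D.J_mul_σ, mul_assoc, D.J_mul_J, mul_neg_one, neg_neg]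

theorem reflection_σ' (a : C) : D.reflection (D.σ' a) = D.σ' a := by
  rw [σ'_apply, map_neg, map_mul, map_mul, reflection_J, reflection_σ]
  simp

theorem reflection_rot (t : ℝ) : D.reflection (D.rot t) = D.rot (-t) := by
  have h : ∀ (r : ℝ) (b : A), D.reflection (r • b) = r • D.reflection b := fun r b => by
    rw [reflection_apply, reflection_apply, mul_smul_comm, smul_mul_assoc]
  rw [coe_rot, coe_rot, map_add, h, h, reflection_J, map_one, Real.cos_neg, Real.sin_neg, smul_neg,
    neg_smul]

theorem reflection_comp_hom (t : ℝ) : D.reflection.comp (D.hom t) = D.hom (-t) := by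
  ext a
  rw [StarAlgHom.comp_apply, hom_apply, hom_apply, map_mul, map_mul, map_star, reflection_rot,
    reflection_σ]

/-- The reflection fixes `σ' a - σ a` and inverts the rotation, so only the `J`-component survives,
doubled. -/
theorem norm_sub_reflection (t : ℝ) (a : C) :
    ‖(D.σ' a - D.σ a) * D.rot (Real.pi / 2 - t) -
        D.reflection ((D.σ' a - D.σ a) * D.rot (Real.pi / 2 - t))‖ =
      2 * |Real.cos t| * ‖D.σ' a - D.σ a‖ := by
  have h : (D.σ' a - D.σ a) * D.rot (Real.pi / 2 - t) -
      D.reflection ((D.σ' a - D.σ a) * D.rot (Real.pi / 2 - t)) =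
      (2 * Real.cos t) • ((D.σ' a - D.σ a) * D.J) := by
    rw [map_mul, map_sub, reflection_σ, reflection_σ', reflection_rot, ← mul_sub, coe_rot, coe_rot,
      Real.cos_neg, Real.sin_neg, Real.sin_pi_div_two_sub, ← mul_smul_comm]
    congr 1
    module
  rw [h, norm_smul, CStarRing.norm_mul_mem_unitary _ D.J_mem_unitary, Real.norm_eq_abs, abs_mul,
    abs_two]

/-- Self-adjointness is what allows lifting to a contraction by real functional calculus. -/
theorem exists_isSelfAdjoint (h : D.σ ≠ D.σ') :
    ∃ a : C, IsSelfAdjoint a ∧ ‖D.σ' a - D.σ a‖ = 1 := by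
  obtain ⟨b, hb, hne⟩ : ∃ b : C, IsSelfAdjoint b ∧ D.σ' b - D.σ b ≠ 0 := by
    by_contra! hcon
    refine h (StarAlgHom.ext fun a => ?_)
    rw [← realPart_add_I_smul_imaginaryPart a, map_add, map_add, map_smul, map_smul,
      sub_eq_zero.1 (hcon _ (realPart a).2), sub_eq_zero.1 (hcon _ (imaginaryPart a).2)]
  refine ⟨((‖D.σ' b - D.σ b‖⁻¹ : ℝ) : ℂ) • b, ?_, ?_⟩
  · rw [Complex.coe_smul]
    exact (IsSelfAdjoint.all _).smul hb
  · rw [map_smul, map_smul, ← smul_sub, norm_smul, Complex.norm_real, norm_inv, norm_norm,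
      inv_mul_cancel₀ (norm_ne_zero_iff.2 hne)]

end RotationData

/-- Nearby rotated copies of `σ` generate elements that the reflection moves far, although it moves
the copies themselves only slightly. -/
theorem RotationData.not_hasTensor {X : CMet.{u}} {C A : UnitalCStar.{u}} (D : RotationData C A)
    (h : D.σ ≠ D.σ') {x₀ x₁ : X} (hx : x₀ ≠ x₁) : ¬ UnitalCStar.HasTensor X C := by
  rintro ⟨T, hT⟩
  obtain ⟨η, hη⟩ := hT.exists_universal
  have hfin : ∀ x, min (edist x₀ x) 1 ≠ ∞ := fun x =>
    ((min_le_right _ _).trans_lt ENNReal.one_lt_top).ne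
  -- The cap at `1` handles infinite distances. The rotation path is `4`-Lipschitz, so the factor
  -- `1/16` makes the family non-expansive and keeps opposite angles within `8 θ ≤ 1/2`.
  let θ : X → ℝ := fun x => (min (edist x₀ x) 1).toReal / 16
  have hθ0 : ∀ x, 0 ≤ θ x := fun x => by positivity
  have hθ1 : ∀ x, θ x ≤ 1 / 16 := fun x => by
    have : (min (edist x₀ x) 1).toReal ≤ 1 :=
      ENNReal.toReal_le_of_le_ofReal zero_le_one (by simp)
    simp only [θ]
    linarith
  have hsub : ∀ x y, ENNReal.ofReal (θ x - θ y) ≤ ENNReal.ofReal (1 / 16) * edist x y := by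
    intro x y
    have h1 : min (edist x₀ x) 1 ≤ min (edist x₀ y) 1 + edist x y := by
      rw [min_add]
      refine le_min (inf_le_left.trans ?_) (inf_le_right.trans le_self_add)
      rw [edist_comm x y]
      exact edist_triangle _ _ _
    have h2 : θ x - θ y =
        1 / 16 * ((min (edist x₀ x) 1).toReal - (min (edist x₀ y) 1).toReal) := by
      simp only [θ]; ring
    rw [h2, ENNReal.ofReal_mul (by norm_num), ENNReal.ofReal_sub _ ENNReal.toReal_nonneg,
      ENNReal.ofReal_toReal (hfin x), ENNReal.ofReal_toReal (hfin y)]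
    gcongr
    exact tsub_le_iff_left.2 h1
  have habs : ∀ x y, ENNReal.ofReal (4 * |θ x - θ y|) ≤ edist x y := by
    intro x y
    have h1 : ENNReal.ofReal |θ x - θ y| ≤ ENNReal.ofReal (1 / 16) * edist x y := by
      rcases abs_choice (θ x - θ y) with h' | h'
      · rw [h']; exact hsub x y
      · rw [h', neg_sub, edist_comm]; exact hsub y x
    rw [ENNReal.ofReal_mul (by norm_num)]
    calc ENNReal.ofReal 4 * ENNReal.ofReal |θ x - θ y|
        ≤ ENNReal.ofReal 4 * (ENNReal.ofReal (1 / 16) * edist x y) := by gcongr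
      _ = ENNReal.ofReal (4 * (1 / 16)) * edist x y := by
        rw [← mul_assoc, ← ENNReal.ofReal_mul (by norm_num)]
      _ ≤ 1 * edist x y := by
        gcongr
        exact ENNReal.ofReal_le_one.2 (by norm_num)
      _ = edist x y := one_mul _
  let F : NonExp X (C →⋆ₐ[ℂ] A) := ⟨fun x => D.hom (θ x), fun x y => by
    rw [ENNReal.coe_one, one_mul]
    exact (D.edist_hom_hom_le _ _).trans (habs x y)⟩
  obtain ⟨f, hf⟩ := (hη A).1 F
  have hfη : ∀ x a, f (η x a) = D.hom (θ x) a := fun x a =>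
    congrArg (fun k : C →⋆ₐ[ℂ] A => k a) (hf x)
  have hupper : edist f (D.reflection.comp f) ≤ ENNReal.ofReal (1 / 2) := by
    rw [(hη A).2]
    refine iSup_le fun x => ?_
    have h1 : (D.reflection.comp f).comp (η x) = D.hom (-θ x) := by
      rw [← D.reflection_comp_hom]
      exact congrArg D.reflection.comp (hf x)
    rw [h1, hf x]
    refine (D.edist_hom_hom_le _ _).trans (ENNReal.ofReal_le_ofReal ?_)
    rw [sub_neg_eq_add, abs_of_nonneg (by linarith [hθ0 x])]
    linarith [hθ1 x]
  have hθx₀ : θ x₀ = 0 := by simp [θ]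
  have hθx₁ : 0 < θ x₁ := by
    have : 0 < (min (edist x₀ x₁) 1).toReal :=
      ENNReal.toReal_pos (lt_min (edist_pos.2 hx) zero_lt_one).ne' (hfin _)
    simp only [θ]
    linarith
  set t := θ x₁ with ht
  have hsin : 0 < Real.sin t :=
    Real.sin_pos_of_pos_of_lt_pi hθx₁ (by linarith [hθ1 x₁, Real.pi_gt_three])
  obtain ⟨a, ha, hna⟩ := D.exists_isSelfAdjoint h
  -- Dividing by `sin t` undoes the smallness of the angle.
  let b : T := (Real.sin t)⁻¹ • (η x₁ a - η x₀ a)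
  have hb : IsSelfAdjoint b := (IsSelfAdjoint.all _).smul ((ha.map _).sub (ha.map _))
  have hfb : f b = (D.σ' a - D.σ a) * D.rot (Real.pi / 2 - t) := by
    have h1 : f b = (Real.sin t)⁻¹ • (f (η x₁ a) - f (η x₀ a)) := by
      rw [← map_sub, ← Complex.coe_smul, ← map_smul, Complex.coe_smul]
    rw [h1, hfη, hfη, hθx₀, D.hom_sub_hom_zero, inv_smul_smul₀ hsin.ne']
  obtain ⟨b', hb', hfb'⟩ := f.exists_norm_le_one_of_isSelfAdjoint hb (by
    rw [hfb, CStarRing.norm_mul_coe_unitary, hna])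
  have hlower : ENNReal.ofReal 1 ≤ edist f (D.reflection.comp f) := by
    refine le_trans ?_ (le_iSup (fun b : {b : T // ‖b‖ ≤ 1} =>
      edist (f b) (D.reflection.comp f b)) ⟨b', hb'⟩)
    rw [edist_dist, dist_eq_norm, StarAlgHom.comp_apply]
    simp only
    rw [hfb', hfb, D.norm_sub_reflection, hna, mul_one]
    refine ENNReal.ofReal_le_ofReal ?_
    have h1 := Real.one_sub_sq_div_two_le_cos (x := t)
    have h2 := le_abs_self (Real.cos t)
    nlinarith [hθ1 x₁]
  have := (ENNReal.ofReal_le_ofReal_iff (by norm_num)).1 (hlower.trans hupper)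
  norm_num at this

namespace UnitalCStar

/-! ### Distinct endomorphisms -/

/-- An algebra of dimension at least two has an endomorphism other than the identity: conjugation
by a unitary that is not central, or a character. -/
theorem exists_endomorphism_ne_id {C : Type*} [CStarAlgebra C] (h : ¬ Module.rank ℂ C ≤ 1) :
    ∃ ρ : C →⋆ₐ[ℂ] C, ρ ≠ StarAlgHom.id ℂ C := by
  by_contra! hall
  -- If all inner automorphisms are trivial, unitaries are central; they span `C`, so `C` is
  -- commutative.
  have hu : ∀ w ∈ unitary C, ∀ a : C, a * w = w * a := by
    intro w hw a
    have h1 := congrArg (fun k : C →⋆ₐ[ℂ] C => k a)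
      (hall (Unitary.conjStarAlgAut ℂ C ⟨w, hw⟩ : C →⋆ₐ[ℂ] C))
    have h2 : w * a * star w = a := h1
    calc a * w = w * a * star w * w := by rw [h2]
      _ = w * a := by rw [mul_assoc, Unitary.star_mul_self_of_mem hw, mul_one]
  have hcomm : ∀ b a : C, a * b = b * a := by
    intro b a
    have hb : b ∈ Submodule.span ℂ (unitary C : Set C) := by
      rw [CStarAlgebra.span_unitary]; trivial
    induction hb using Submodule.span_induction with
    | mem w hw => exact hu w hw a
    | zero => simp
    | add x y _ _ hx hy => rw [mul_add, add_mul, hx, hy]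
    | smul r x _ hx => rw [mul_smul_comm, smul_mul_assoc, hx]
  let _ : CommCStarAlgebra C := { ‹CStarAlgebra C› with mul_comm := fun a b => hcomm b a }
  have hnt : Nontrivial C := by
    by_contra hn
    rw [not_nontrivial_iff_subsingleton] at hn
    exact h (rank_le_one_iff.2 ⟨0, fun v => ⟨0, Subsingleton.elim _ _⟩⟩)
  -- The endomorphism `a ↦ φ(a) 1` must also be the identity, which forces `C = ℂ 1`.
  obtain ⟨φ⟩ : Nonempty (WeakDual.characterSpace ℂ C) := inferInstance
  have hφ := hall ((StarAlgHom.ofId ℂ C).comp (φ : C →⋆ₐ[ℂ] ℂ))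
  refine h (rank_le_one_iff.2 ⟨1, fun a => ⟨φ a, ?_⟩⟩)
  rw [← Algebra.algebraMap_eq_smul_one]
  exact congrArg (fun k : C →⋆ₐ[ℂ] C => k a) hφ

/-! ### Two-by-two matrices -/

/-- The diagonal homomorphism with the given entries. -/
noncomputable def diagonalHom {C : Type*} [CStarAlgebra C] (f g : C →⋆ₐ[ℂ] C) :
    C →⋆ₐ[ℂ] CStarMatrix (Fin 2) (Fin 2) C where
  toFun a := CStarMatrix.ofMatrix !![f a, 0; 0, g a]
  map_one' := by
    ext i j; fin_cases i <;> fin_cases j <;> simp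
  map_mul' a b := by
    ext i j; fin_cases i <;> fin_cases j <;> simp [CStarMatrix.mul_apply]
  map_zero' := by
    ext i j; fin_cases i <;> fin_cases j <;> simp
  map_add' a b := by
    ext i j; fin_cases i <;> fin_cases j <;> simp
  commutes' r := by
    ext i j
    fin_cases i <;> fin_cases j <;> simp [CStarMatrix.algebraMap_apply, AlgHomClass.commutes]
  map_star' a := by
    ext i j; fin_cases i <;> fin_cases j <;> simp [CStarMatrix.star_apply, map_star]

theorem diagonalHom_apply {C : Type*} [CStarAlgebra C] (f g : C →⋆ₐ[ℂ] C) (a : C) :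
    diagonalHom f g a = CStarMatrix.ofMatrix !![f a, 0; 0, g a] := rfl

attribute [local instance] CStarAlgebra.spectralOrder CStarAlgebra.spectralOrderedRing

/-- The rotation data that an endomorphism `ρ` gives in two-by-two matrices. -/
noncomputable def matrixRotationData {C : Type*} [CStarAlgebra C] (ρ : C →⋆ₐ[ℂ] C) :
    RotationData C (CStarMatrix (Fin 2) (Fin 2) C) where
  σ := diagonalHom (StarAlgHom.id ℂ C) ρ
  σ' := diagonalHom ρ (StarAlgHom.id ℂ C)
  J := CStarMatrix.ofMatrix !![0, -1; 1, 0]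
  w := CStarMatrix.ofMatrix !![1, 0; 0, -1]
  star_J := by
    ext i j; fin_cases i <;> fin_cases j <;> simp [CStarMatrix.star_apply]
  J_mul_J := by
    ext i j; fin_cases i <;> fin_cases j <;> simp [CStarMatrix.mul_apply]
  star_w := by
    ext i j; fin_cases i <;> fin_cases j <;> simp [CStarMatrix.star_apply]
  w_mul_w := by
    ext i j; fin_cases i <;> fin_cases j <;> simp [CStarMatrix.mul_apply]
  w_mul_J := by
    ext i j; fin_cases i <;> fin_cases j <;> simp [CStarMatrix.mul_apply]
  w_mul_σ a := by
    ext i j; fin_cases i <;> fin_cases j <;> simp [diagonalHom_apply, CStarMatrix.mul_apply]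
  J_mul_σ a := by
    ext i j; fin_cases i <;> fin_cases j <;> simp [diagonalHom_apply, CStarMatrix.mul_apply]

theorem not_hasTensor {X : CMet.{u}} {C : UnitalCStar.{u}} {x₀ x₁ : X} (hx : x₀ ≠ x₁)
    (h : ¬ Module.rank ℂ C ≤ 1) : ¬ HasTensor X C := by
  obtain ⟨ρ, hρ⟩ := exists_endomorphism_ne_id h
  refine RotationData.not_hasTensor (A := ⟨CStarMatrix (Fin 2) (Fin 2) C⟩) (matrixRotationData ρ)
    (fun heq => hρ (StarAlgHom.ext fun a => ?_)) hx
  have h1 := congrArg (fun k : C →⋆ₐ[ℂ] CStarMatrix (Fin 2) (Fin 2) C => k a 0 0) heq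
  exact h1.symm

theorem exists_not_hasTensor : ∃ (X : CMet.{u}) (C : UnitalCStar.{u}), ¬ HasTensor X C := by
  -- `K` is `ℂ²` in the required universe; it serves both as the space and as the algebra, and `δ`
  -- is not a scalar.
  let K := C(ULift.{u} Bool, ℂ)
  let δ : K := ⟨fun i => if i.down then 1 else 0, continuous_of_discreteTopology⟩
  refine ⟨⟨K⟩, ⟨K⟩, not_hasTensor (x₀ := (0 : K)) (x₁ := (1 : K)) zero_ne_one fun h => ?_⟩
  obtain ⟨r, hr⟩ := exists_smul_one_eq (C := K) h δ
  have h0 : r = 0 := by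
    have := DFunLike.congr_fun hr ⟨false⟩
    rw [ContinuousMap.smul_apply, ContinuousMap.one_apply, smul_eq_mul, mul_one] at this
    exact this.trans (if_neg (c := false = true) (t := (1 : ℂ)) Bool.false_ne_true)
  have h1 : r = 1 := by
    have := DFunLike.congr_fun hr ⟨true⟩
    rw [ContinuousMap.smul_apply, ContinuousMap.one_apply, smul_eq_mul, mul_one] at this
    exact this.trans (if_pos (c := true = true) (e := (0 : ℂ)) rfl)
  exact zero_ne_one (h0.symm.trans h1)

end UnitalCStar

/-! ### The classification of existing tensor products -/

theorem mainTheorem11 :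
    (∀ (X : CMet.{u}) (C : UnitalCStar.{u}),
      (UnitalCStar.HasTensor X C ↔
        IsEmpty X ∨ Nonempty (Unique X) ∨ Module.rank ℂ C ≤ 1) ∧
      (IsEmpty X →
        ∀ T : UnitalCStar.{u}, UnitalCStar.IsTensor X C T ↔ Nonempty (T ≃⋆ₐ[ℂ] ℂ)) ∧
      (Nonempty (Unique X) →
        ∀ T : UnitalCStar.{u}, UnitalCStar.IsTensor X C T ↔ Nonempty (T ≃⋆ₐ[ℂ] C)) ∧
      (Nonempty X → Module.rank ℂ C ≤ 1 →
        ∀ T : UnitalCStar.{u}, UnitalCStar.IsTensor X C T ↔ Nonempty (T ≃⋆ₐ[ℂ] C))) ∧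
    ¬ UnitalCStarIsCMetTensored.{u} := by
  refine ⟨fun X C => ⟨⟨fun h => ?_, ?_⟩, ?_, ?_, ?_⟩, fun h => ?_⟩
  · by_contra! hcon
    obtain ⟨hne, hnu, hr⟩ := hcon
    obtain ⟨x₀⟩ := hne
    by_cases hx : ∃ x₁, x₀ ≠ x₁
    · obtain ⟨x₁, hx⟩ := hx
      exact UnitalCStar.not_hasTensor hx hr.not_ge h
    · push Not at hx
      exact hnu.elim ⟨⟨x₀⟩, fun x => (hx x).symm⟩
  · rintro (hX | ⟨⟨hX⟩⟩ | hC)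
    · exact ⟨_, UnitalCStar.isTensor_complex_of_isEmpty X C⟩
    · exact ⟨_, UnitalCStar.isTensor_self_of_unique X C⟩
    · rcases isEmpty_or_nonempty X with hX | hX
      · exact ⟨_, UnitalCStar.isTensor_complex_of_isEmpty X C⟩
      · exact ⟨_, UnitalCStar.isTensor_self_of_rank_le_one X C hC⟩
  · intro hX T
    rw [(UnitalCStar.isTensor_complex_of_isEmpty X C).iff_nonempty_starAlgEquiv]
    exact ⟨fun ⟨e⟩ => ⟨e.trans UnitalCStar.complexEquiv⟩,
      fun ⟨e⟩ => ⟨e.trans UnitalCStar.complexEquiv.symm⟩⟩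
  · rintro ⟨hX⟩ T
    exact (UnitalCStar.isTensor_self_of_unique X C).iff_nonempty_starAlgEquiv T
  · intro hX hC T
    exact (UnitalCStar.isTensor_self_of_rank_le_one X C hC).iff_nonempty_starAlgEquiv T
  · obtain ⟨X, C, hXC⟩ := UnitalCStar.exists_not_hasTensor.{u}
    exact hXC (h X C)
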